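/- A sign pattern of order $n\ge 1$ is an $n\times n$ matrix $\mathcal P=[p_{ij}]$ with entries in $\{+,-,0\}$; its qualitative class $Q(\mathcal P)$ is the set of real $n\times n$ matrices $B=[b_{ij}]$ such that $b_{ij}$ has sign $p_{ij}$ for all $i,j$. The pattern $\mathcal P$ is sign semi-stable if every eigenvalue of every $B\in Q(\mathcal P)$ has nonpositive real part. The sepr-sequence of a real $n\times n$ matrix $B$ is $t_1t_2\cdots t_n$, where $t_k$ is determined by the principal minors of $B$ of order $k$: $t_k=\mathtt A^{+}$ (respectively $\mathtt A^{-}$) if all are positive (respectively negative); $t_k=\mathtt A^{*}$ if all are nonzero and both signs occur; $t_k=\mathtt N$ if all are zero; $t_k=\mathtt S^{+}$ (respectively $\mathtt S^{-}$) if both zero and nonzero ones occur and all nonzero ones are positive (respectively negative); $t_k=\mathtt S^{*}$ if positive, negative and zero ones all occur. The pattern $\mathcal P$ has a unique sepr-sequence if all $B\in Q(\mathcal P)$ have the same sepr-sequence; its terms are then denoted $t_k(\mathcal P)$. The digraph $\Gamma(\mathcal P)$ has vertices $1,\dots,n$ and an arc $(i,j)$ whenever $p_{ij}\ne 0$ (a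 loop if $i=j$). The simplified pattern of $\mathcal P$ is obtained from $\mathcal P$ by replacing by $0$ every entry $p_{ij}$ such that $(i,j)$ does not lie on a (directed, simple) cycle of $\Gamma(\mathcal P)$, loops being cycles of length one. For a digraph $\Gamma$, $\operatorname{match}(\Gamma)$ is the maximum number of edges in a matching of its underlying simple graph (in which distinct $u,v$ are adjacent if $(u,v)$ or $(v,u)$ is an arc), and a perfect matching of $\Gamma$ is one of this graph. Let $\mathcal P$ be an $n\times n$ sign semi-stable pattern. All indices below range over $\{1,\dots,n\}$. (a) $\mathcal P$ has a unique sepr-sequence, in which $t_k(\mathcal P)\in\{\mathtt N,\mathtt S^{+},\mathtt A^{+}\}$ if $k$ is even, and $t_k(\mathcal P)\in\{\mathtt N,\mathtt S^{-},\mathtt A^{-}\}$ if $k$ is odd. (b) If $t_k(\mathcal P)\in\{\mathtt A^{+},\mathtt A^{-}\}$, then $t_\ell(\mathcal P)\in\{\mathtt A^{+},\mathtt A^{-}\}$ for $\ell=k,\dots,n$, with $\mathtt A^{+}$ and $\mathtt A^{-}$ alternating. (c) If $t_k(\mathcal P)=\mathtt N$, then $t_{k+2}(\mathcal P)=\mathtt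 N$ provided $k+2\le n$; moreover, if $k$ is even, then $t_j(\mathcal P)=\mathtt N$ for all $j\ge k$. (d) Suppose $t_1(\mathcal P)=\mathtt N$ and let $\mathcal Q$ be the simplified pattern of $\mathcal P$. Then $t_k(\mathcal P)=\mathtt S^{+}$ if $k$ is even, $k<n$ and $k\le 2\operatorname{match}(\Gamma(\mathcal Q))$; $t_n(\mathcal P)=\mathtt A^{+}$ if $\Gamma(\mathcal Q)$ has a perfect matching; and $t_k(\mathcal P)=\mathtt N$ if $k$ is odd or $k>2\operatorname{match}(\Gamma(\mathcal Q))$. -/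

import Mathlib

/-- The possible terms of an sepr-sequence: `A*`, `A⁺`, `A⁻`, `N`, `S*`, `S⁺`, `S⁻`. -/
inductive SeprTerm : Type
  | Astar
  | Aplus
  | Aminus
  | N
  | Sstar
  | Splus
  | Sminus

/-- A (square) sign pattern of order `n`: a matrix whose entries are signs `0`, `-1`, `1`. -/
abbrev SignPattern (n : ℕ) : Type := Matrix (Fin n) (Fin n) SignType

/-- The indices `1, …, n` of the terms of an sepr-sequence of length `n`. -/
abbrev SeprIndex (n : ℕ) : Type := Set.Icc 1 n

/-- The principal minor of `B` with rows and columns in `α`. -/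
noncomputable def principalMinor {n : ℕ} (B : Matrix (Fin n) (Fin n) ℝ)
    (α : Finset (Fin n)) : ℝ :=
  (B.submatrix (fun i : α => (i : Fin n)) (fun i : α => (i : Fin n))).det

/-- Some principal minor of `B` of order `k` has sign `s`. -/
def HasMinorOfSign {n : ℕ} (B : Matrix (Fin n) (Fin n) ℝ) (k : ℕ) (s : SignType) : Prop :=
  ∃ α : Finset (Fin n), α.card = k ∧ SignType.sign (principalMinor B α) = s

open Classical in
/-- The `k`-th term of the sepr-sequence of `B`, for `1 ≤ k ≤ n`
(so that there is at least one principal minor of order `k`):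
* no zero minor of order `k`: `A*`, `A⁺` or `A⁻`;
* a zero minor and a nonzero one: `S*`, `S⁺` or `S⁻`;
* only zero minors: `N`. -/
noncomputable def seprTerm {n : ℕ} (B : Matrix (Fin n) (Fin n) ℝ) (k : ℕ) : SeprTerm :=
  if HasMinorOfSign B k 0 then
    if HasMinorOfSign B k 1 then
      if HasMinorOfSign B k (-1) then SeprTerm.Sstar else SeprTerm.Splus
    else
      if HasMinorOfSign B k (-1) then SeprTerm.Sminus else SeprTerm.N
  else
    if HasMinorOfSign B k 1 then
      if HasMinorOfSign B k (-1) then SeprTerm.Astar else SeprTerm.Aplus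
    else SeprTerm.Aminus

/-- The sepr-sequence `t₁ t₂ ⋯ tₙ` of a real matrix of order `n`. -/
noncomputable def sepr {n : ℕ} (B : Matrix (Fin n) (Fin n) ℝ) : SeprIndex n → SeprTerm :=
  fun k => seprTerm B k

/-- A real square matrix is semi-stable if each of its (complex) eigenvalues has
nonpositive real part. -/
def Matrix.IsSemiStable {n : ℕ} (B : Matrix (Fin n) (Fin n) ℝ) : Prop :=
  ∀ z : ℂ, Module.End.HasEigenvalue (Matrix.toLin' (B.map (fun x : ℝ => (x : ℂ)))) z → z.re ≤ 0

namespace SignPattern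

variable {n : ℕ}

/-- The qualitative class `Q(P)`: the real matrices whose entries have the signs given by `P`. -/
def qualClass (P : SignPattern n) : Set (Matrix (Fin n) (Fin n) ℝ) :=
  {B | ∀ i j, SignType.sign (B i j) = P i j}

/-- The sepr-set of `P`: the set of sepr-sequences of the matrices in `Q(P)`. -/
def seprSet (P : SignPattern n) : Set (SeprIndex n → SeprTerm) :=
  sepr '' P.qualClass

/-- `P` is sign semi-stable if every matrix in `Q(P)` is semi-stable. -/
def IsSignSemiStable (P : SignPattern n) : Prop :=
  ∀ B ∈ P.qualClass, B.IsSemiStable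

/-- The digraph of `P`: there is an arc (possibly a loop) from `i` to `j` iff `P i j ≠ 0`. -/
def digraph (P : SignPattern n) : Digraph (Fin n) where
  Adj i j := P i j ≠ 0

end SignPattern

/-- The distinct vertices `v 0, …, v m` are, in this order, the vertices of an
`(m + 1)`-cycle of the digraph `Γ`. The addition in `Fin (m + 1)` is cyclic,
so the last arc is from `v m` to `v 0`; a loop is a cycle of length one (`m = 0`). -/
def Digraph.IsCycle {V : Type*} (Γ : Digraph V) {m : ℕ} (v : Fin (m + 1) → V) : Prop :=
  Function.Injective v ∧ ∀ a, Γ.Adj (v a) (v (a + 1))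

/-- The arc from `i` to `j` is part of a cycle of `Γ`. -/
def Digraph.ArcOnCycle {V : Type*} (Γ : Digraph V) (i j : V) : Prop :=
  ∃ (m : ℕ) (v : Fin (m + 1) → V), Γ.IsCycle v ∧ ∃ a, v a = i ∧ v (a + 1) = j

open Classical in
/-- The simplified pattern of `P`: every entry `(i, j)` that is not part of a cycle
of the digraph of `P` is set to zero. -/
noncomputable def SignPattern.simplified {n : ℕ} (P : SignPattern n) : SignPattern n :=
  fun i j => if P.digraph.ArcOnCycle i j then P i j else 0

/-- The matching number of a simple graph on a finite vertex set: the maximum number of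
edges in a matching. -/
noncomputable def SimpleGraph.matchNumber {V : Type*} [Finite V] (G : SimpleGraph V) : ℕ :=
  sSup {m : ℕ | ∃ M : G.Subgraph, M.IsMatching ∧ M.edgeSet.ncard = m}

/-- The underlying simple graph of the digraph of `P`: distinct `u` and `v` are adjacent iff
at least one of the arcs `(u, v)`, `(v, u)` is present; loops are ignored. -/
def SignPattern.underlyingGraph {n : ℕ} (P : SignPattern n) : SimpleGraph (Fin n) :=
  P.digraph.toSimpleGraphInclusive

/-! Semi-stability survives when entries of a matrix in the class are replaced by zero, because the
bound `z.re ^ n ≤ ‖det (z - B)‖` passes to limits. Hence every matrix supported on part of the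
pattern has no eigenvalue in the open right half-plane. Testing this on a single cycle shows that
cycles have length at most two (`isCycle_le`); testing it on a single permutation shows that no term
of the Leibniz expansion of `det (-A)` is negative (`det_neg_nonneg`). Thus nothing cancels, and a
principal minor on `α` has sign `(-1) ^ α.card` if `α` splits into loops and 2-cycles, and is zero
otherwise (`sign_principalMinor`).

The sepr-sequence therefore depends only on which vertex sets are matched. `N` propagates because
orbits can be removed from a matched set. `A` propagates because the 2-cycles form a forest, which
is bipartite (`isMatched_of_forall_card`). Without loops, matched sets are exactly the vertex sets
of matchings in that forest, which is the underlying graph of the simplified pattern. -/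

open Matrix Polynomial

/-! ### Spectra of matrices in the closure of the qualitative class. -/

theorem Matrix.IsSemiStable.re_pow_le_norm_eval_charpoly {n : ℕ} {B : Matrix (Fin n) (Fin n) ℝ}
    (hB : B.IsSemiStable) {z : ℂ} (hz : 0 < z.re) :
    z.re ^ n ≤ ‖(B.map (fun x : ℝ => (x : ℂ))).charpoly.eval z‖ := by
  set A := B.map (fun x : ℝ => (x : ℂ)) with hA
  have hs : A.charpoly.Splits := IsAlgClosed.splits _
  have hroot : ∀ w ∈ A.charpoly.roots, z.re ≤ ‖z - w‖ := by
    intro w hw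
    have hw' : w.re ≤ 0 := by
      apply hB
      rw [← hA, Module.End.hasEigenvalue_iff_isRoot_charpoly, charpoly_toLin']
      exact (Polynomial.mem_roots (charpoly_monic A).ne_zero).mp hw
    have h1 := Complex.re_le_norm (z - w)
    rw [Complex.sub_re] at h1
    linarith
  have hcard : A.charpoly.roots.card = n := by
    rw [← hs.natDegree_eq_card_roots, charpoly_natDegree_eq_dim, Fintype.card_fin]
  rw [hs.eval_eq_prod_roots_of_monic (charpoly_monic A)]
  have key : ∀ s : Multiset ℂ, (∀ w ∈ s, z.re ≤ ‖z - w‖) →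
      z.re ^ s.card ≤ ‖(s.map (fun w => z - w)).prod‖ := by
    intro s
    induction s using Multiset.induction_on with
    | empty => simp
    | cons a s ih =>
      intro h
      rw [Multiset.card_cons, Multiset.map_cons, Multiset.prod_cons, norm_mul, pow_succ']
      exact mul_le_mul (h a (Multiset.mem_cons_self a s))
        (ih fun w hw => h w (Multiset.mem_cons_of_mem hw)) (by positivity) (norm_nonneg _)
  simpa only [hcard] using key _ hroot

namespace SignPattern

variable {n : ℕ} {P : SignPattern n}

theorem det_scalar_sub_ne_zero_of_subpattern (hP : P.IsSignSemiStable)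
    {A : Matrix (Fin n) (Fin n) ℝ} (hA : ∀ i j, A i j = 0 ∨ SignType.sign (A i j) = P i j)
    {z : ℂ} (hz : 0 < z.re) : (scalar (Fin n) z - A.map (fun x : ℝ => (x : ℂ))).det ≠ 0 := by
  -- `A` is the limit of `C ε` as `ε → 0`, and `C ε` lies in the class for `ε > 0`; the lower bound
  -- on `‖F ε‖` does not depend on `ε`.
  let C : ℝ → Matrix (Fin n) (Fin n) ℝ := fun ε => of fun i j => A i j + ε * (P i j : ℝ)
  let F : ℝ → ℂ := fun ε => (scalar (Fin n) z - (C ε).map (fun x : ℝ => (x : ℂ))).det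
  have hC : ∀ ε, 0 < ε → C ε ∈ P.qualClass := by
    intro ε hε i j
    change SignType.sign (A i j + ε * (P i j : ℝ)) = P i j
    rcases hA i j with h | h
    · rw [h, zero_add]
      rcases P i j with _ | _ | _ <;> simp [hε]
    · rcases hp : P i j with _ | _ | _ <;> rw [hp] at h
      · have := sign_eq_zero_iff.mp h
        simp [this]
      · have := sign_eq_neg_one_iff.mp h
        apply sign_eq_neg_one_iff.mpr
        simp
        linarith
      · have := sign_eq_one_iff.mp h
        apply sign_eq_one_iff.mpr
        simp
        linarith
  have hF : Continuous F := by
    apply Continuous.matrix_det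
    apply Continuous.sub continuous_const
    apply continuous_matrix
    intro i j
    change Continuous fun ε : ℝ => ((A i j + ε * (P i j : ℝ) : ℝ) : ℂ)
    fun_prop
  have hlow : ∀ ε ∈ Set.Ioi (0 : ℝ), z.re ^ n ≤ ‖F ε‖ := by
    intro ε hε
    have h := (hP _ (hC ε hε)).re_pow_le_norm_eval_charpoly hz
    rwa [eval_charpoly] at h
  have h0 : (0 : ℝ) ∈ closure (Set.Ioi (0 : ℝ)) := by simp
  have hlim : z.re ^ n ≤ ‖F 0‖ :=
    closure_minimal hlow (isClosed_le continuous_const hF.norm) h0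
  have hC0 : C 0 = A := by
    ext i j
    simp [C]
  intro hdet
  have : F 0 = 0 := by
    simp only [F, hC0, hdet]
  rw [this, norm_zero] at hlim
  exact absurd hlim (not_le.mpr (pow_pos hz n))

/-- Real matrices whose nonzero entries have the signs of the entries of `P` at the places
given by an injection of the index types have no eigenvalues in the open right half-plane. -/
theorem det_scalar_sub_ne_zero (hP : P.IsSignSemiStable) {ι : Type*} [Fintype ι] [DecidableEq ι]
    {e : ι → Fin n} (he : Function.Injective e) {A : Matrix ι ι ℝ}
    (hA : ∀ i j, A i j = 0 ∨ SignType.sign (A i j) = P (e i) (e j))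
    {z : ℂ} (hz : 0 < z.re) : (scalar ι z - A.map (fun x : ℝ => (x : ℂ))).det ≠ 0 := by
  classical
  intro hdet
  obtain ⟨x, hx0, hx⟩ := exists_mulVec_eq_zero_iff.mpr hdet
  -- Both the matrix and its eigenvector are extended by zero along `e`, so the eigenvalue `z`
  -- persists.
  let A' : Matrix (Fin n) (Fin n) ℝ := of fun a b =>
    if h : (∃ i, e i = a) ∧ ∃ j, e j = b then A h.1.choose h.2.choose else 0
  have hA'e : ∀ i j, A' (e i) (e j) = A i j := by
    intro i j
    have h : (∃ i', e i' = e i) ∧ ∃ j', e j' = e j := ⟨⟨i, rfl⟩, ⟨j, rfl⟩⟩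
    simp only [A', of_apply, dif_pos h]
    rw [he h.1.choose_spec, he h.2.choose_spec]
  have hA'0 : ∀ a b, (¬ ∃ i, e i = a) → A' a b = 0 := by
    intro a b h
    simp only [A', of_apply]
    rw [dif_neg (fun h' => h h'.1)]
  have hA' : ∀ a b, A' a b = 0 ∨ SignType.sign (A' a b) = P a b := by
    intro a b
    by_cases h : (∃ i, e i = a) ∧ ∃ j, e j = b
    · obtain ⟨⟨i, rfl⟩, ⟨j, rfl⟩⟩ := h
      rw [hA'e]
      exact hA i j
    · left
      simp only [A', of_apply, dif_neg h]
  apply det_scalar_sub_ne_zero_of_subpattern hP hA' hz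
  apply exists_mulVec_eq_zero_iff.mp
  let y : Fin n → ℂ := Function.extend e x 0
  have hye : ∀ i, y (e i) = x i := fun i => he.extend_apply _ _ _
  have hy0 : ∀ a, (¬ ∃ i, e i = a) → y a = 0 := fun a h => Function.extend_apply' _ _ _ h
  refine ⟨y, ?_, ?_⟩
  · intro h
    apply hx0
    ext i
    rw [← hye, h]
    rfl
  · have hsum : ∀ g : Fin n → ℂ, ∑ b, g b * y b = ∑ j, g (e j) * x j := by
      intro g
      symm
      simp only [← hye]
      apply Fintype.sum_of_injective e he (fun j => g (e j) * y (e j))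
        (fun b => g b * y b)
      · intro b hb
        rw [hy0 b (by simpa using hb), mul_zero]
      · intro i
        rfl
    ext a
    rw [sub_mulVec, Pi.sub_apply]
    simp only [mulVec, dotProduct, map_apply, hsum, scalar_apply, Pi.zero_apply]
    by_cases h : ∃ i, e i = a
    · obtain ⟨i, rfl⟩ := h
      have hi := congrFun hx i
      rw [sub_mulVec, Pi.sub_apply] at hi
      simp only [mulVec, dotProduct, map_apply, scalar_apply, Pi.zero_apply] at hi
      rw [← hi]
      simp only [diagonal_apply, hA'e, he.eq_iff]
    · have : ∀ j, a ≠ e j := fun j hj => h ⟨j, hj.symm⟩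
      simp [this, hA'0 a _ h]

/-- `det (-A)` is the characteristic polynomial at 0. That polynomial is monic, so a negative value
there would force a positive real root. -/
theorem det_neg_nonneg (hP : P.IsSignSemiStable) {ι : Type*} [Fintype ι] [DecidableEq ι]
    {e : ι → Fin n} (he : Function.Injective e) {A : Matrix ι ι ℝ}
    (hA : ∀ i j, A i j = 0 ∨ SignType.sign (A i j) = P (e i) (e j)) : 0 ≤ (-A).det := by
  by_contra! hneg
  have h0 : A.charpoly.eval 0 < 0 := by
    rw [eval_charpoly]
    simpa using hneg
  have hne : ∀ x : ℝ, 0 < x → A.charpoly.eval x ≠ 0 := by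
    intro x hx h
    rw [eval_charpoly] at h
    apply det_scalar_sub_ne_zero hP he hA (z := (x : ℂ)) (by simpa using hx)
    have h2 := congrArg Complex.ofRealHom h
    rw [RingHom.map_det, map_zero] at h2
    rw [← h2]
    congr 1
    ext i j
    simp [diagonal_apply, apply_ite Complex.ofReal]
  have hdeg : 0 < A.charpoly.degree := by
    rw [charpoly_degree_eq_dim]
    by_contra! h
    have hc : Fintype.card ι = 0 := by
      have : ((Fintype.card ι : ℕ) : WithBot ℕ) ≤ ((0 : ℕ) : WithBot ℕ) := h
      exact Nat.le_zero.mp (WithBot.coe_le_coe.mp this)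
    have : IsEmpty ι := Fintype.card_eq_zero_iff.mp hc
    rw [det_isEmpty] at hneg
    linarith
  have htop := A.charpoly.tendsto_atTop_of_leadingCoeff_nonneg hdeg
    (by rw [(charpoly_monic A).leadingCoeff]; exact zero_le_one)
  obtain ⟨x, hx, hx0⟩ := ((htop.eventually_gt_atTop 0).and (Filter.eventually_gt_atTop 0)).exists
  obtain ⟨y, hy, hy0⟩ := intermediate_value_Ioo hx0.le A.charpoly.continuous.continuousOn
    (show (0 : ℝ) ∈ Set.Ioo _ _ from ⟨h0, hx⟩)
  exact hne y hy.1 hy0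

/-- The cycles of the digraph of a sign semi-stable pattern have length at most two. -/
theorem IsSignSemiStable.isCycle_le (hP : P.IsSignSemiStable) {m : ℕ} {v : Fin (m + 1) → Fin n}
    (hv : P.digraph.IsCycle v) : m ≤ 1 := by
  by_contra! hm
  let s : Fin (m + 1) → ℝ := fun a => (P (v a) (v (a + 1)) : ℝ)
  have hs : ∀ a, s a * s a = 1 := by
    intro a
    have := hv.2 a
    change P (v a) (v (a + 1)) ≠ 0 at this
    simp only [s]
    rcases hp : P (v a) (v (a + 1)) with _ | _ | _
    · exact absurd hp this
    · simp
    · simp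
  let A : Matrix (Fin (m + 1)) (Fin (m + 1)) ℝ := of fun a b => if b = a + 1 then s a else 0
  have hA : ∀ i j, A i j = 0 ∨ SignType.sign (A i j) = P (v i) (v j) := by
    intro i j
    simp only [A, of_apply]
    split_ifs with h
    · subst h
      right
      simp only [s]
      rcases P (v i) (v (i + 1)) with _ | _ | _ <;> simp
    · exact Or.inl rfl
  -- The characteristic equation of a signed cycle is `z ^ (m + 1) = ±1`; for the sign `-1`, the
  -- root of angle `π / (m + 1)` has positive real part exactly because `m + 1 > 2`.
  obtain ⟨z, hz, hzm⟩ : ∃ z : ℂ, 0 < z.re ∧ z ^ (m + 1) = ∏ a, (s a : ℂ) := by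
    have hsq : (∏ a, s a) * ∏ a, s a = 1 := by
      rw [← Finset.prod_mul_distrib]
      exact Finset.prod_eq_one fun a _ => hs a
    rcases mul_self_eq_one_iff.mp hsq with h | h
    · refine ⟨1, by simp, ?_⟩
      rw [← Complex.ofReal_prod, h]
      simp
    · refine ⟨Complex.exp ((Real.pi / (m + 1) : ℝ) * Complex.I), ?_, ?_⟩
      · rw [Complex.exp_ofReal_mul_I_re]
        have hpi := Real.pi_pos
        have hm' : (2 : ℝ) < m + 1 := by exact_mod_cast Nat.lt_succ_of_le hm
        apply Real.cos_pos_of_mem_Ioo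
        constructor
        · have : 0 < Real.pi / (m + 1) := by positivity
          linarith
        · exact div_lt_div_of_pos_left hpi two_pos hm'
      · rw [← Complex.ofReal_prod, h, ← Complex.exp_nat_mul]
        have : ((m + 1 : ℕ) : ℂ) * ((Real.pi / (m + 1) : ℝ) * Complex.I) = Real.pi * Complex.I := by
          have : (m : ℂ) + 1 ≠ 0 := by exact_mod_cast Nat.succ_ne_zero m
          push_cast
          field_simp
        rw [this, Complex.exp_pi_mul_I]
        simp
  have hs' : ∀ a, (s a : ℂ) * s a = 1 := fun a => by exact_mod_cast hs a
  apply det_scalar_sub_ne_zero hP hv.1 hA hz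
  apply exists_mulVec_eq_zero_iff.mp
  -- Solves `z * x a = s a * x (a + 1)` from `x 0 = 1`, using `s a * s a = 1`; closing up at the
  -- last vertex is the equation `hzm`.
  let x : Fin (m + 1) → ℂ := fun a => z ^ (a : ℕ) * ∏ b ∈ Finset.Iio a, (s b : ℂ)
  refine ⟨x, ?_, ?_⟩
  · intro h
    have h0 := congrFun h 0
    have : Finset.Iio (0 : Fin (m + 1)) = ∅ := by
      ext a
      simp
    simp [x, this] at h0
  · ext a
    rw [sub_mulVec, Pi.sub_apply]
    have hAx : ((A.map (fun x : ℝ => (x : ℂ))) *ᵥ x) a = s a * x (a + 1) := by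
      simp only [mulVec, dotProduct, map_apply, A, of_apply, apply_ite Complex.ofReal]
      simp
    have hzx : (scalar (Fin (m + 1)) z *ᵥ x) a = z * x a := by
      simp [scalar_apply, mulVec_diagonal]
    rw [hAx, hzx, Pi.zero_apply, sub_eq_zero]
    simp only [x]
    induction a using Fin.lastCases with
    | last =>
      have h1 : Finset.Iio (0 : Fin (m + 1)) = ∅ := by
        ext a
        simp
      rw [Fin.last_add_one, h1, ← mul_assoc, Fin.val_last, ← pow_succ', hzm]
      have h2 : (Finset.univ : Finset (Fin (m + 1))) =
          insert (Fin.last m) (Finset.Iio (Fin.last m)) := by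
        ext a
        simp only [Finset.mem_univ, Finset.mem_insert, Finset.mem_Iio, Fin.lt_last_iff_ne_last,
          true_iff]
        exact em _
      have h3 : (∏ b ∈ Finset.Iio (Fin.last m), (s b : ℂ)) *
          ∏ b ∈ Finset.Iio (Fin.last m), (s b : ℂ) = 1 := by
        rw [← Finset.prod_mul_distrib]
        exact Finset.prod_eq_one fun a _ => hs' a
      rw [h2, Finset.prod_insert (by simp)]
      simp only [Fin.val_zero, pow_zero, Finset.prod_empty, mul_one]
      rw [mul_assoc, h3, mul_one]
    | cast a =>
      have h2 : Finset.Iio (a.castSucc + 1) = insert a.castSucc (Finset.Iio a.castSucc) := by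
        ext b
        rw [Fin.coeSucc_eq_succ]
        rw [Finset.mem_insert, Finset.mem_Iio, Finset.mem_Iio, Fin.lt_def, Fin.lt_def, Fin.ext_iff,
          Fin.val_succ, Fin.val_castSucc]
        lia
      rw [h2, Finset.prod_insert (by simp), Fin.coeSucc_eq_succ, Fin.val_succ, Fin.val_castSucc,
        pow_succ]
      linear_combination (-z ^ (a : ℕ) * z * ∏ b ∈ Finset.Iio a.castSucc, (s b : ℂ)) * hs' a.castSucc

end SignPattern

/-! ### Signs of principal minors. -/

namespace SignPattern

variable {n : ℕ} {P : SignPattern n}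

/-- The set `α` is the disjoint union of vertex sets of cycles of length one or two
of the digraph of `P`. -/
def IsMatched (P : SignPattern n) (α : Finset (Fin n)) : Prop :=
  ∃ f : Fin n → Fin n, ∀ i ∈ α, f i ∈ α ∧ f (f i) = i ∧ P i (f i) ≠ 0

/-- The orbit of `i` under `g` is a cycle of the digraph, so its length is 1 or 2. -/
theorem apply_apply_eq_self (hP : P.IsSignSemiStable) {ι : Type*} [Finite ι] {e : ι → Fin n}
    (he : Function.Injective e) {g : ι → ι} (hg : Function.Injective g)
    (hPg : ∀ i, P (e i) (e (g i)) ≠ 0) (i : ι) : g (g i) = i := by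
  have hpos : 0 < Function.minimalPeriod g i :=
    Function.minimalPeriod_pos_of_mem_periodicPts (hg.mem_periodicPts i)
  obtain ⟨m, hm⟩ := Nat.exists_eq_add_of_lt hpos
  rw [zero_add] at hm
  have hcyc : P.digraph.IsCycle (m := m) (fun a => e (g^[a] i)) := by
    constructor
    · intro a b hab
      apply Fin.ext
      exact Function.iterate_injOn_Iio_minimalPeriod (by simpa only [Set.mem_Iio, hm] using a.2)
        (by simpa only [Set.mem_Iio, hm] using b.2) (he hab)
    · intro a
      change P (e (g^[a] i)) (e (g^[(a + 1 : Fin (m + 1))] i)) ≠ 0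
      have : g^[(a + 1 : Fin (m + 1))] i = g (g^[a] i) := by
        rw [← Function.iterate_succ_apply' g]
        induction a using Fin.lastCases with
        | last =>
          have h := Function.iterate_minimalPeriod (f := g) (x := i)
          rw [hm] at h
          rw [Fin.last_add_one, Fin.val_last, Fin.val_zero, h]
          rfl
        | cast a => rw [Fin.coeSucc_eq_succ, Fin.val_succ, Fin.val_castSucc]
      rw [this]
      exact hPg _
  have hle := hP.isCycle_le hcyc
  have h2 : Function.IsPeriodicPt g 2 i := by
    apply (Function.isPeriodicPt_minimalPeriod g i).trans_dvd
    rw [hm]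
    interval_cases m <;> simp
  exact h2

theorem isMatched_iff_exists_perm (hP : P.IsSignSemiStable) (α : Finset (Fin n)) :
    P.IsMatched α ↔ ∃ σ : Equiv.Perm α, ∀ i, P (σ i) i ≠ 0 := by
  classical
  constructor
  · rintro ⟨f, hf⟩
    let g : α → α := fun i => ⟨f i, (hf i i.2).1⟩
    have hg : Function.Involutive g := fun i => Subtype.ext (hf i i.2).2.1
    refine ⟨hg.toPerm g, fun i => ?_⟩
    have h := hf _ (hf i i.2).1
    rw [(hf i i.2).2.1] at h
    exact h.2.2
  · rintro ⟨σ, hσ⟩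
    -- The Leibniz formula uses entries `(σ i, i)`, so the arcs leave `i` along `σ.symm`.
    have hσ' : ∀ i : α, P i (σ.symm i) ≠ 0 := fun i => by simpa using hσ (σ.symm i)
    have hinv := apply_apply_eq_self hP Subtype.val_injective σ.symm.injective hσ'
    refine ⟨fun i => if h : i ∈ α then σ.symm ⟨i, h⟩ else i, fun i hi => ?_⟩
    simp only [dif_pos hi, Subtype.coe_eta, Finset.coe_mem, dite_true, true_and]
    exact ⟨congrArg Subtype.val (hinv ⟨i, hi⟩), hσ' ⟨i, hi⟩⟩

theorem sign_principalMinor (hP : P.IsSignSemiStable) {B : Matrix (Fin n) (Fin n) ℝ}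
    (hB : B ∈ P.qualClass) (α : Finset (Fin n)) [Decidable (P.IsMatched α)] :
    SignType.sign (principalMinor B α) = if P.IsMatched α then (-1) ^ α.card else 0 := by
  classical
  set A : Matrix α α ℝ := B.submatrix (fun i : α => (i : Fin n)) (fun i : α => (i : Fin n)) with hA
  have hterm : ∀ σ : Equiv.Perm α, 0 ≤ (Equiv.Perm.sign σ : ℝ) * ∏ i, (-A) (σ i) i := by
    intro σ
    -- Keeping only the entries selected by `σ` leaves one Leibniz term, whose sign is then given by
    -- `det_neg_nonneg`.
    let C : Matrix α α ℝ := of fun i j => if σ j = i then A i j else 0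
    have hC := det_neg_nonneg hP Subtype.val_injective (A := C) (by
      intro i j
      simp only [C, of_apply]
      split_ifs
      · exact Or.inr (hB i j)
      · exact Or.inl rfl)
    rw [det_apply', Finset.sum_eq_single σ] at hC
    · simpa [C] using hC
    · intro τ _ hτ
      obtain ⟨j, hj⟩ : ∃ j, τ j ≠ σ j := by
        by_contra! h
        exact hτ (Equiv.ext h)
      rw [Finset.prod_eq_zero (Finset.mem_univ j), mul_zero]
      simp [C, hj.symm]
    · simp
  have hne : ∀ σ : Equiv.Perm α, (Equiv.Perm.sign σ : ℝ) * ∏ i, (-A) (σ i) i ≠ 0 ↔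
      ∀ i, P (σ i) i ≠ 0 := by
    intro σ
    have h1 : (((Equiv.Perm.sign σ : ℤˣ) : ℤ) : ℝ) ≠ 0 := by
      exact_mod_cast (Equiv.Perm.sign σ).ne_zero
    rw [mul_ne_zero_iff, Finset.prod_ne_zero_iff]
    simp only [h1, ne_eq, not_false_eq_true, true_and, Finset.mem_univ, true_implies]
    refine forall_congr' fun i => not_congr ?_
    rw [← hB (σ i) i, sign_eq_zero_iff]
    simp [hA]
  have hdet : principalMinor B α = (-1) ^ α.card * (-A).det := by
    rw [det_neg, Fintype.card_coe, ← mul_assoc, ← mul_pow]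
    simp [principalMinor, hA]
  rw [hdet, sign_mul, sign_pow, Left.sign_neg, sign_one]
  split_ifs with h
  · obtain ⟨σ, hσ⟩ := (isMatched_iff_exists_perm hP α).mp h
    have : 0 < (-A).det := by
      rw [det_apply']
      exact Finset.sum_pos' (fun σ _ => hterm σ)
        ⟨σ, Finset.mem_univ _, (hterm σ).lt_of_ne' ((hne σ).mpr hσ)⟩
    rw [sign_pos this, mul_one]
  · have : (-A).det = 0 := by
      rw [det_apply']
      refine Finset.sum_eq_zero fun σ _ => ?_
      by_contra h0
      exact h ((isMatched_iff_exists_perm hP α).mpr ⟨σ, (hne σ).mp h0⟩)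
    rw [this, sign_zero, mul_zero]

/-! ### Matched sets of vertices -/

theorem IsMatched.sdiff_orbit {α : Finset (Fin n)} {f : Fin n → Fin n}
    (hf : ∀ i ∈ α, f i ∈ α ∧ f (f i) = i ∧ P i (f i) ≠ 0) {i : Fin n} (hi : i ∈ α) :
    P.IsMatched (α \ {i, f i}) := by
  refine ⟨f, fun j hj => ?_⟩
  simp only [Finset.mem_sdiff, Finset.mem_insert, Finset.mem_singleton, not_or] at hj ⊢
  obtain ⟨hfj, hffj, hPj⟩ := hf j hj.1
  refine ⟨⟨hfj, fun h => ?_, fun h => ?_⟩, hffj, hPj⟩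
  · rw [h] at hffj
    exact hj.2.2 hffj.symm
  · have := (hf i hi).2.1
    rw [← h, hffj] at this
    exact hj.2.1 this

/-- Remove a 2-cycle if there is one; otherwise every vertex carries a loop and any subset is
matched. -/
theorem IsMatched.exists_of_card_add_two {α : Finset (Fin n)} {k : ℕ} (hα : P.IsMatched α)
    (hc : α.card = k + 2) : ∃ β, P.IsMatched β ∧ β.card = k := by
  obtain ⟨f, hf⟩ := hα
  by_cases h : ∃ i ∈ α, f i ≠ i
  · obtain ⟨i, hi, hne⟩ := h
    refine ⟨_, IsMatched.sdiff_orbit hf hi, ?_⟩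
    rw [Finset.card_sdiff_of_subset, Finset.card_pair hne.symm, hc, Nat.add_sub_cancel]
    simp [Finset.insert_subset_iff, hi, (hf i hi).1]
  · push Not at h
    obtain ⟨β, hβ, hβc⟩ := Finset.exists_subset_card_eq (s := α) (n := k) (by lia)
    refine ⟨β, ⟨f, fun i hi => ?_⟩, hβc⟩
    have := hf i (hβ hi)
    rw [h i (hβ hi)] at this ⊢
    exact ⟨hi, h i (hβ hi), this.2.2⟩

theorem even_card_of_forall_apply_ne {α : Finset (Fin n)} {f : Fin n → Fin n}
    (hf : ∀ i ∈ α, f i ∈ α ∧ f (f i) = i ∧ P i (f i) ≠ 0) (hne : ∀ i ∈ α, f i ≠ i) :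
    Even α.card := by
  -- Modulo 2, the two members of each pair contribute `1 + 1 = 0`.
  have h : ∑ _i ∈ α, (1 : ZMod 2) = 0 :=
    Finset.sum_involution (fun i _ => f i) (fun _ _ => by decide) (fun i hi _ => hne i hi)
      (fun i hi => (hf i hi).1) (fun i hi => (hf i hi).2.1)
  rw [Finset.sum_const, nsmul_one] at h
  exact ZMod.natCast_eq_zero_iff_even.mp h

theorem IsMatched.even_card {α : Finset (Fin n)} (hα : P.IsMatched α) (h0 : ∀ i, P i i = 0) :
    Even α.card := by
  obtain ⟨f, hf⟩ := hα
  refine even_card_of_forall_apply_ne hf fun i hi h => ?_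
  have := (hf i hi).2.2
  rw [h] at this
  exact this (h0 i)

/-- By parity a matched set of odd size contains a fixed point, which can be removed. -/
theorem IsMatched.exists_of_card_add_one {α : Finset (Fin n)} {k : ℕ} (hk : Even k)
    (hα : P.IsMatched α) (hc : α.card = k + 1) : ∃ β, P.IsMatched β ∧ β.card = k := by
  obtain ⟨f, hf⟩ := hα
  obtain ⟨i, hi, hfi⟩ : ∃ i ∈ α, f i = i := by
    by_contra! h
    have := even_card_of_forall_apply_ne hf h
    rw [hc] at this
    exact Nat.not_even_iff_odd.mpr hk.add_one this
  refine ⟨_, IsMatched.sdiff_orbit hf hi, ?_⟩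
  rw [hfi, Finset.pair_eq_singleton, Finset.card_sdiff_of_subset (by simpa), hc]
  simp

theorem IsMatched.exists_of_card_le {α : Finset (Fin n)} {k : ℕ} (hk : Even k)
    (hα : P.IsMatched α) (hc : k ≤ α.card) : ∃ β, P.IsMatched β ∧ β.card = k := by
  obtain ⟨d, hd⟩ := Nat.exists_eq_add_of_le hc
  induction d using Nat.strong_induction_on generalizing α with
  | _ d ih =>
    match d with
    | 0 => exact ⟨α, hα, hd⟩
    | 1 => exact hα.exists_of_card_add_one hk hd
    | d + 2 =>
      obtain ⟨β, hβ, hβc⟩ := hα.exists_of_card_add_two (k := k + d) hd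
      exact ih d (by lia) hβ (by lia) hβc

/-- Edges here carry arcs in both directions, so a graph cycle would be a directed cycle of length
at least 3. -/
theorem isAcyclic_toSimpleGraphStrict (hP : P.IsSignSemiStable) :
    P.digraph.toSimpleGraphStrict.IsAcyclic := by
  rw [SimpleGraph.isAcyclic_iff_free_cycleGraph]
  rintro m hm ⟨φ⟩
  obtain ⟨m, rfl⟩ := Nat.exists_eq_add_of_le' hm
  have := hP.isCycle_le (m := m + 2) (v := φ) ⟨φ.injective, fun a => by
    have h : (SimpleGraph.cycleGraph (m + 3)).Adj a (a + 1) := by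
      rw [SimpleGraph.cycleGraph_adj]
      simp
    exact (φ.toHom.map_adj h).2.1⟩
  lia

/-- If all sets of `k ≥ 1` vertices are matched, then so are all sets of `k + 1` vertices. -/
theorem isMatched_of_forall_card (hP : P.IsSignSemiStable) {k : ℕ} (hk : 1 ≤ k)
    (h : ∀ β : Finset (Fin n), β.card = k → P.IsMatched β) {α : Finset (Fin n)}
    (hα : α.card = k + 1) : P.IsMatched α := by
  classical
  have herase : ∀ v ∈ α, P.IsMatched (α.erase v) := fun v hv =>
    h _ (by rw [Finset.card_erase_of_mem hv, hα, Nat.add_sub_cancel])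
  -- With a loop at `v`, the matching of `α.erase v` extends by fixing `v`.
  by_cases hloop : ∃ v ∈ α, P v v ≠ 0
  · obtain ⟨v, hv, hPv⟩ := hloop
    obtain ⟨f, hf⟩ := herase v hv
    refine ⟨Function.update f v v, fun i hi => ?_⟩
    by_cases hiv : i = v
    · subst hiv
      simp [hi, hPv]
    · obtain ⟨h1, h2, h3⟩ := hf i (Finset.mem_erase.mpr ⟨hiv, hi⟩)
      rw [Finset.mem_erase] at h1
      rw [Function.update_of_ne hiv, Function.update_of_ne h1.1]
      exact ⟨h1.2, h2, h3⟩
  · exfalso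
    push Not at hloop
    obtain ⟨c⟩ := (isAcyclic_toSimpleGraphStrict hP).colorable_two
    -- Weights `±1` from a 2-colouring of the forest: each 2-cycle has weight zero, so the total
    -- over `α` equals `w v` for every `v ∈ α`.
    let w : Fin n → ℤ := fun i => if c i = 0 then 1 else -1
    have hsum : ∀ v ∈ α, ∑ i ∈ α.erase v, w i = 0 := by
      intro v hv
      obtain ⟨f, hf⟩ := herase v hv
      have hne : ∀ i ∈ α.erase v, f i ≠ i := by
        intro i hi hfi
        have := (hf i hi).2.2
        rw [hfi] at this
        exact this (hloop i (Finset.mem_of_mem_erase hi))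
      refine Finset.sum_involution (fun i _ => f i) (fun i hi => ?_) (fun i hi _ => hne i hi)
        (fun i hi => (hf i hi).1) (fun i hi => (hf i hi).2.1)
      have hadj : P.digraph.toSimpleGraphStrict.Adj i (f i) := by
        refine ⟨(hne i hi).symm, (hf i hi).2.2, ?_⟩
        have := (hf _ (hf i hi).1).2.2
        rwa [(hf i hi).2.1] at this
      have hcol := c.valid hadj
      simp only [w]
      split_ifs with h1 h2 h2
      · exact absurd (h1.trans h2.symm) hcol
      · rfl
      · rfl
      · exact absurd (by lia) hcol
    have hconst : ∀ v ∈ α, w v = ∑ i ∈ α, w i := by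
      intro v hv
      rw [← Finset.add_sum_erase α w hv, hsum v hv, add_zero]
    -- Summing the constant weight over `α` multiplies it by `α.card`; as it is nonzero, `α.card =
    -- 1`, contrary to `k + 1 ≥ 2`.
    have htot : ∑ i ∈ α, w i = α.card * ∑ i ∈ α, w i := by
      conv_lhs => rw [Finset.sum_congr rfl hconst]
      simp
    obtain ⟨v, hv⟩ := Finset.card_pos.mp (show 0 < α.card by lia)
    have hw : w v ≠ 0 := by
      simp only [w]
      split_ifs <;> simp
    rw [hconst v hv] at hw
    have : (α.card : ℤ) = 1 := mul_right_cancel₀ hw (by rw [← htot, one_mul])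
    lia

end SignPattern

/-! ### Matchings and the matching number of finite graphs. -/

namespace SimpleGraph.Subgraph

/-- Handshake lemma: degrees are 1 on the matched vertices and 0 elsewhere. -/
theorem IsMatching.two_mul_ncard_edgeSet {V : Type*} [Finite V] {G : SimpleGraph V}
    {M : G.Subgraph} (hM : M.IsMatching) : 2 * M.edgeSet.ncard = M.verts.ncard := by
  classical
  have := Fintype.ofFinite V
  rw [← edgeSet_spanningCoe, Set.ncard_eq_toFinset_card', Set.ncard_eq_toFinset_card']
  change 2 * M.spanningCoe.edgeFinset.card = _
  rw [← SimpleGraph.sum_degrees_eq_twice_card_edges]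
  have hdeg : ∀ v, M.spanningCoe.degree v = if v ∈ M.verts.toFinset then 1 else 0 := by
    intro v
    rw [degree_spanningCoe]
    split_ifs with h
    · exact isMatching_iff_forall_degree.mp hM v (Set.mem_toFinset.mp h)
    · exact M.degree_of_notMem_verts fun hv => h (Set.mem_toFinset.mpr hv)
  simp [hdeg]

end SimpleGraph.Subgraph

namespace SimpleGraph

variable {V : Type*} [Finite V] (G : SimpleGraph V)

/-- Ensures that the `sSup` defining `matchNumber` is attained and bounds every matching. -/
theorem bddAbove_ncard_edgeSet_isMatching :
    BddAbove {m : ℕ | ∃ M : G.Subgraph, M.IsMatching ∧ M.edgeSet.ncard = m} := by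
  refine ⟨Nat.card V, ?_⟩
  rintro m ⟨M, hM, rfl⟩
  have h1 := hM.two_mul_ncard_edgeSet
  have h2 := Set.ncard_le_card M.verts
  lia

theorem exists_isMatching_ncard_eq_matchNumber :
    ∃ M : G.Subgraph, M.IsMatching ∧ M.edgeSet.ncard = G.matchNumber :=
  Nat.sSup_mem (s := {m : ℕ | ∃ M : G.Subgraph, M.IsMatching ∧ M.edgeSet.ncard = m})
    ⟨_, ⊥, fun _ h => h.elim, rfl⟩ G.bddAbove_ncard_edgeSet_isMatching

variable {G} in
theorem Subgraph.IsMatching.ncard_edgeSet_le {M : G.Subgraph} (hM : M.IsMatching) :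
    M.edgeSet.ncard ≤ G.matchNumber :=
  le_csSup G.bddAbove_ncard_edgeSet_isMatching ⟨M, hM, rfl⟩

end SimpleGraph

/-! ### Matched sets as matchings of the simplified pattern. -/

namespace SignPattern

variable {n : ℕ} {P : SignPattern n}

/-- As cycles have length at most two, an arc between distinct vertices lies on a cycle exactly when
its reverse is present. -/
theorem underlyingGraph_simplified (hP : P.IsSignSemiStable) :
    P.simplified.underlyingGraph = P.digraph.toSimpleGraphStrict := by
  have hback : ∀ i j, i ≠ j → P.simplified i j ≠ 0 → P i j ≠ 0 ∧ P j i ≠ 0 := by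
    intro i j hij h
    rw [simplified] at h
    split_ifs at h with hc
    · refine ⟨h, ?_⟩
      obtain ⟨m, v, hv, a, rfl, rfl⟩ := hc
      have := hP.isCycle_le hv
      interval_cases m
      · exact absurd (congrArg v (Subsingleton.elim (α := Fin 1) _ _)) hij
      · have h2 : a + 1 + 1 = a := by
          exact (by decide : ∀ a : Fin 2, a + 1 + 1 = a) a
        have h3 := hv.2 (a + 1)
        rwa [h2] at h3
    · exact absurd rfl h
  have hforth : ∀ i j, i ≠ j → P i j ≠ 0 → P j i ≠ 0 → P.simplified i j ≠ 0 := by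
    intro i j hij h1 h2
    have hc : P.digraph.ArcOnCycle i j := by
      refine ⟨1, ![i, j], ⟨?_, ?_⟩, 0, rfl, rfl⟩
      · intro a b hab
        fin_cases a <;> fin_cases b <;> simp_all
      · intro a
        fin_cases a
        · exact h1
        · exact h2
    rwa [simplified, if_pos hc]
  ext i j
  constructor
  · rintro ⟨hij, h | h⟩
    · exact ⟨hij, hback i j hij h⟩
    · exact ⟨hij, (hback j i hij.symm h).symm⟩
  · rintro ⟨hij, h1, h2⟩
    exact ⟨hij, Or.inl (hforth i j hij h1 h2)⟩

theorem isMatched_of_isMatching {M : P.digraph.toSimpleGraphStrict.Subgraph} (hM : M.IsMatching)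
    {α : Finset (Fin n)} (hα : (α : Set (Fin n)) = M.verts) : P.IsMatched α := by
  classical
  have hmem : ∀ i, i ∈ α ↔ i ∈ M.verts := fun i => by rw [← hα, Finset.mem_coe]
  choose! f hf using fun i (hi : i ∈ M.verts) => (hM hi).exists
  refine ⟨f, fun i hi => ?_⟩
  have hadj := hf i ((hmem i).mp hi)
  have hfi : f i ∈ M.verts := M.edge_vert hadj.symm
  exact ⟨(hmem _).mpr hfi, hM.eq_of_adj_left (hf _ hfi) hadj.symm, hadj.adj_sub.2.1⟩

theorem IsMatched.exists_isMatching {α : Finset (Fin n)} (hα : P.IsMatched α)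
    (h0 : ∀ i, P i i = 0) :
    ∃ M : P.digraph.toSimpleGraphStrict.Subgraph, M.IsMatching ∧ M.verts = α := by
  obtain ⟨f, hf⟩ := hα
  refine ⟨{ verts := α, Adj := fun i j => i ∈ α ∧ f i = j, adj_sub := ?_, edge_vert := And.left,
            symm := ⟨?_⟩ }, ?_, rfl⟩
  · rintro i j ⟨hi, rfl⟩
    refine ⟨fun h => ?_, (hf i hi).2.2, ?_⟩
    · have := (hf i hi).2.2
      rw [← h] at this
      exact this (h0 i)
    · have := (hf _ (hf i hi).1).2.2
      rwa [(hf i hi).2.1] at this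
  · rintro i j ⟨hi, rfl⟩
    exact ⟨(hf i hi).1, (hf i hi).2.1⟩
  · intro i hi
    exact ⟨f i, ⟨hi, rfl⟩, fun j hj => hj.2.symm⟩

/-! ### The sepr-sequence of a sign semi-stable pattern -/

open Classical in
/-- The `k`-th term of the sepr-sequence of a sign semi-stable pattern. -/
noncomputable def term (P : SignPattern n) (k : ℕ) : SeprTerm :=
  if ∀ α : Finset (Fin n), α.card = k → P.IsMatched α then
    if Even k then SeprTerm.Aplus else SeprTerm.Aminus
  else if ∃ α : Finset (Fin n), α.card = k ∧ P.IsMatched α then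
    if Even k then SeprTerm.Splus else SeprTerm.Sminus
  else SeprTerm.N

theorem seprTerm_eq_term (hP : P.IsSignSemiStable) {B : Matrix (Fin n) (Fin n) ℝ}
    (hB : B ∈ P.qualClass) {k : ℕ} (hk : k ≤ n) : seprTerm B k = P.term k := by
  classical
  have hpow : ((-1 : SignType) ^ k) = if Even k then 1 else -1 := by
    split_ifs with h
    · exact h.neg_one_pow
    · exact (Nat.not_even_iff_odd.mp h).neg_one_pow
  have h0 : HasMinorOfSign B k 0 ↔ ¬ ∀ α : Finset (Fin n), α.card = k → P.IsMatched α := by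
    push Not
    refine exists_congr fun α => and_congr_right fun hα => ?_
    rw [sign_principalMinor hP hB, hα, hpow]
    split_ifs <;> simp_all
  have h1 : ∀ s : SignType, s ≠ 0 → (HasMinorOfSign B k s ↔ (-1 : SignType) ^ k = s ∧
      ∃ α : Finset (Fin n), α.card = k ∧ P.IsMatched α) := by
    intro s hs
    constructor
    · rintro ⟨α, hα, h⟩
      rw [sign_principalMinor hP hB, hα] at h
      split_ifs at h with hm
      · exact ⟨h, α, hα, hm⟩
      · exact absurd h.symm hs
    · rintro ⟨h, α, hα, hm⟩
      exact ⟨α, hα, by rw [sign_principalMinor hP hB, if_pos hm, hα, h]⟩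
  -- For `k > n` both terms would be defaults, and they would disagree for even `k`; `k ≤ n`
  -- supplies an actual minor.
  have hex : (∀ α : Finset (Fin n), α.card = k → P.IsMatched α) →
      ∃ α : Finset (Fin n), α.card = k ∧ P.IsMatched α := by
    intro h
    obtain ⟨α, -, hα⟩ := Finset.exists_subset_card_eq (s := (Finset.univ : Finset (Fin n)))
      (n := k) (by simpa using hk)
    exact ⟨α, hα, h α hα⟩
  rw [seprTerm, term]
  simp only [h0, h1 1 (by decide), h1 (-1) (by decide), hpow]
  by_cases hall : ∀ α : Finset (Fin n), α.card = k → P.IsMatched α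
  · have := hex hall
    rw [if_neg (not_not.mpr hall), if_pos hall]
    by_cases hev : Even k <;> simp [this, hev]
  · by_cases hsome : ∃ α : Finset (Fin n), α.card = k ∧ P.IsMatched α <;>
      by_cases hev : Even k <;> simp only [hall, hsome, hev] <;> simp

theorem term_mem_A_iff {k : ℕ} : (P.term k = SeprTerm.Aplus ∨ P.term k = SeprTerm.Aminus) ↔
    ∀ α : Finset (Fin n), α.card = k → P.IsMatched α := by
  rw [term]
  by_cases hall : ∀ α : Finset (Fin n), α.card = k → P.IsMatched α
  · rw [if_pos hall]
    split_ifs <;> simpa using hall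
  · rw [if_neg hall, iff_false_right hall]
    split_ifs <;> simp

theorem term_eq_N_iff {k : ℕ} (hk : k ≤ n) : P.term k = SeprTerm.N ↔
    ∀ α : Finset (Fin n), α.card = k → ¬ P.IsMatched α := by
  obtain ⟨α, -, hα⟩ := Finset.exists_subset_card_eq (s := (Finset.univ : Finset (Fin n)))
    (n := k) (by simpa using hk)
  rw [term]
  split_ifs with h1 _ h2 _
  · simpa using ⟨α, hα, h1 α hα⟩
  · simpa using ⟨α, hα, h1 α hα⟩
  · simpa using h2
  · simpa using h2
  · simpa using h2

/-- Nonemptiness of the class, without which `seprSet` would be empty. -/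
theorem toReal_mem_qualClass (P : SignPattern n) :
    (of fun i j => (P i j : ℝ)) ∈ P.qualClass := by
  intro i j
  rw [of_apply]
  rcases P i j with _ | _ | _ <;> simp

theorem isMatched_of_le (hP : P.IsSignSemiStable) {k l : ℕ} (hk : 1 ≤ k) (hkl : k ≤ l)
    (h : ∀ α : Finset (Fin n), α.card = k → P.IsMatched α) :
    ∀ α : Finset (Fin n), α.card = l → P.IsMatched α := by
  induction l, hkl using Nat.le_induction with
  | base => exact h
  | succ l hkl ih => exact fun α hα => isMatched_of_forall_card hP (hk.trans hkl) ih hα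

theorem apply_self_eq_zero (hn : 1 ≤ n) (h : P.term 1 = SeprTerm.N) (i : Fin n) : P i i = 0 := by
  by_contra hi
  apply (term_eq_N_iff hn).mp h {i} (Finset.card_singleton i)
  refine ⟨id, fun j hj => ?_⟩
  rw [Finset.mem_singleton] at hj
  subst hj
  exact ⟨Finset.mem_singleton_self j, rfl, hi⟩

theorem IsMatched.card_le {α : Finset (Fin n)} (hα : P.IsMatched α) (h0 : ∀ i, P i i = 0) :
    α.card ≤ 2 * P.digraph.toSimpleGraphStrict.matchNumber := by
  obtain ⟨M, hM, hv⟩ := hα.exists_isMatching h0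
  have h1 := hM.two_mul_ncard_edgeSet
  have h2 := hM.ncard_edgeSet_le
  rw [hv, Set.ncard_coe_finset] at h1
  lia

theorem exists_isMatched_card_eq {k : ℕ} (hk : Even k)
    (hle : k ≤ 2 * P.digraph.toSimpleGraphStrict.matchNumber) :
    ∃ α : Finset (Fin n), α.card = k ∧ P.IsMatched α := by
  classical
  obtain ⟨M, hM, hcard⟩ := P.digraph.toSimpleGraphStrict.exists_isMatching_ncard_eq_matchNumber
  have h1 := hM.two_mul_ncard_edgeSet
  rw [hcard, Set.ncard_eq_toFinset_card'] at h1
  obtain ⟨β, hβ, hβc⟩ := (isMatched_of_isMatching hM (Set.coe_toFinset M.verts)).exists_of_card_le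
    hk (by lia)
  exact ⟨β, hβc, hβ⟩

theorem term_eq_Splus (hP : P.IsSignSemiStable) (h0 : ∀ i, P i i = 0) {k : ℕ} (hk1 : 1 ≤ k)
    (hkn : k < n) (hk : Even k) (hle : k ≤ 2 * P.digraph.toSimpleGraphStrict.matchNumber) :
    P.term k = SeprTerm.Splus := by
  -- Otherwise all sets of odd size `k + 1` would be matched too, impossible without loops.
  have hnot : ¬ ∀ α : Finset (Fin n), α.card = k → P.IsMatched α := by
    intro h
    obtain ⟨α, -, hα⟩ := Finset.exists_subset_card_eq (s := (Finset.univ : Finset (Fin n)))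
      (n := k + 1) (by simpa using hkn)
    have := (isMatched_of_forall_card hP hk1 h hα).even_card h0
    rw [hα] at this
    exact Nat.not_even_iff_odd.mpr hk.add_one this
  rw [term, if_neg hnot, if_pos (exists_isMatched_card_eq hk hle), if_pos hk]

theorem term_eq_Aplus_of_isPerfectMatching (h0 : ∀ i, P i i = 0)
    {M : P.digraph.toSimpleGraphStrict.Subgraph} (hM : M.IsPerfectMatching) :
    P.term n = SeprTerm.Aplus := by
  have huniv : P.IsMatched Finset.univ := by
    apply isMatched_of_isMatching hM.1
    rw [Finset.coe_univ, SimpleGraph.Subgraph.isSpanning_iff.mp hM.2]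
  have hall : ∀ α : Finset (Fin n), α.card = n → P.IsMatched α := by
    intro α hα
    rwa [(Finset.card_eq_iff_eq_univ α).mp (by simpa using hα)]
  have hev := huniv.even_card h0
  rw [Finset.card_univ, Fintype.card_fin] at hev
  rw [term, if_pos hall, if_pos hev]

end SignPattern

/-! ### Assembly of the four assertions. -/

theorem mainTheorem3 (n : ℕ) (P : SignPattern n) (hP : P.IsSignSemiStable) :
    ∃ t : SeprIndex n → SeprTerm,
      -- `t` is the unique sepr-sequence of `P`
      P.seprSet = {t} ∧
      -- even-indexed and odd-indexed terms
      (∀ k : SeprIndex n,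
        (Even (k : ℕ) → t k = SeprTerm.N ∨ t k = SeprTerm.Splus ∨ t k = SeprTerm.Aplus) ∧
        (Odd (k : ℕ) → t k = SeprTerm.N ∨ t k = SeprTerm.Sminus ∨ t k = SeprTerm.Aminus)) ∧
      -- once an `A`-term appears, `A⁺` and `A⁻` alternate to the end
      (∀ k : SeprIndex n, (t k = SeprTerm.Aplus ∨ t k = SeprTerm.Aminus) →
        (∀ l : SeprIndex n, k ≤ l → t l = SeprTerm.Aplus ∨ t l = SeprTerm.Aminus) ∧
        (∀ l m : SeprIndex n, k ≤ l → (m : ℕ) = l + 1 → t l ≠ t m)) ∧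
      -- propagation of `N`
      (∀ k : SeprIndex n, t k = SeprTerm.N →
        (∀ l : SeprIndex n, (l : ℕ) = k + 2 → t l = SeprTerm.N) ∧
        (Even (k : ℕ) → ∀ j : SeprIndex n, k ≤ j → t j = SeprTerm.N)) ∧
      -- the case `t₁ = N`
      (∀ hn : 1 ≤ n, t ⟨1, le_refl 1, hn⟩ = SeprTerm.N →
        (∀ k : SeprIndex n, (k : ℕ) < n → Even (k : ℕ) →
          (k : ℕ) ≤ 2 * P.simplified.underlyingGraph.matchNumber → t k = SeprTerm.Splus) ∧
        ((∃ M : P.simplified.underlyingGraph.Subgraph, M.IsPerfectMatching) →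
          t ⟨n, hn, le_refl n⟩ = SeprTerm.Aplus) ∧
        (∀ k : SeprIndex n,
          (Odd (k : ℕ) ∨ 2 * P.simplified.underlyingGraph.matchNumber < (k : ℕ)) →
            t k = SeprTerm.N)) := by
  rw [SignPattern.underlyingGraph_simplified hP]
  refine ⟨fun k => P.term k, ?_, fun k => ⟨fun hk => ?_, fun hk => ?_⟩, fun k hk => ?_,
    fun k hk => ⟨fun l hl => ?_, fun hev j hj => ?_⟩, fun hn h1 => ?_⟩
  · apply Set.eq_singleton_iff_unique_mem.mpr
    constructor
    · exact ⟨_, P.toReal_mem_qualClass, funext fun k =>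
        SignPattern.seprTerm_eq_term hP P.toReal_mem_qualClass k.2.2⟩
    · rintro _ ⟨B, hB, rfl⟩
      exact funext fun k => SignPattern.seprTerm_eq_term hP hB k.2.2
  · simp only [SignPattern.term]
    split_ifs <;> simp
  · have := Nat.not_even_iff_odd.mpr hk
    simp only [SignPattern.term]
    split_ifs <;> simp
  · have hall := fun (l : SeprIndex n) (hl : k ≤ l) =>
      SignPattern.isMatched_of_le hP k.2.1 hl (SignPattern.term_mem_A_iff.mp hk)
    refine ⟨fun l hl => SignPattern.term_mem_A_iff.mpr (hall l hl), fun l m hl hm => ?_⟩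
    have hkm : k ≤ m := hl.trans (show (l : ℕ) ≤ m by lia)
    simp only [SignPattern.term]
    rw [if_pos (hall l hl), if_pos (hall m hkm), hm]
    simp only [Nat.even_add_one]
    split_ifs <;> simp
  · refine (SignPattern.term_eq_N_iff l.2.2).mpr fun α hα hm => ?_
    obtain ⟨β, hβ, hβc⟩ := hm.exists_of_card_add_two (hα.trans hl)
    exact (SignPattern.term_eq_N_iff k.2.2).mp hk β hβc hβ
  · refine (SignPattern.term_eq_N_iff j.2.2).mpr fun α hα hm => ?_
    obtain ⟨β, hβ, hβc⟩ := hm.exists_of_card_le hev (hα ▸ hj)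
    exact (SignPattern.term_eq_N_iff k.2.2).mp hk β hβc hβ
  · have h0 := SignPattern.apply_self_eq_zero hn h1
    refine ⟨fun k hkn hk hle => SignPattern.term_eq_Splus hP h0 k.2.1 hkn hk hle,
      fun ⟨M, hM⟩ => SignPattern.term_eq_Aplus_of_isPerfectMatching h0 hM, fun k hk => ?_⟩
    refine (SignPattern.term_eq_N_iff k.2.2).mpr fun α hα hm => ?_
    rcases hk with hk | hk
    · exact Nat.not_even_iff_odd.mpr hk (hα ▸ hm.even_card h0)
    · have := hm.card_le h0
      lia
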